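/- Let $\mathcal T$ be a triangulated category (the octahedral axiom included). By a heart on $\mathcal T$ we mean the heart $\mathcal A=\mathcal T^{\le 0}\cap\mathcal T^{\ge 0}$ of a bounded t-structure on $\mathcal T$, where bounded means that every object lies in $\mathcal T^{\le b}\cap\mathcal T^{\ge a}$ for some integers $a,b$; it is a full subcategory of $\mathcal T$ and an abelian category, and every short exact sequence $0\to X_1\to X_2\to X_3\to 0$ in $\mathcal A$ extends in a unique way to a distinguished triangle $X_1\to X_2\to X_3\to X_1[1]$, whose last morphism is called the connecting morphism of the sequence. A realization functor for $\mathcal A$ is an exact functor $\mathsf{real}\colon \mathrm D^{\mathrm b}(\mathcal A)\to\mathcal T$ whose restriction to $\mathcal A$ (embedded in $\mathrm D^{\mathrm b}(\mathcal A)$ as complexes in degree $0$) is isomorphic to the inclusion $\mathcal A\subset\mathcal T$. The category $\mathcal T$ is called realized if for every full triangulated subcategory $\mathcal S\subset\mathcal T$ and every heart $\mathcal B$ on $\mathcal S$ there exists a realization functor $\mathrm D^{\mathrm b}(\mathcal B)\to\mathcal S$. For $A,B\in\mathcal A$ and $n\in\mathbb N$ let $f_{n,A,B}\colon \mathrm{Ext}^n_{\mathcal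 A}(A,B)\to\mathrm{Hom}_{\mathcal T}(A,B[n])$ be the following well-defined group homomorphism: $f_{0,A,B}$ is the inclusion $\mathrm{Hom}_{\mathcal A}(A,B)=\mathrm{Hom}_{\mathcal T}(A,B)$; for $n\ge 1$, the class of an $n$-extension $0\to B\to X_1\to\dots\to X_n\to A\to 0$, split into short exact sequences $0\to C_{i-1}\to X_i\to C_i\to 0$ for $i=1,\dots,n$ (with $C_0=B$ and $C_n=A$), is sent to the composite $A\to C_{n-1}[1]\to\dots\to C_1[n-1]\to B[n]$ of the (shifted) connecting morphisms. We say that $\mathcal T$ has all the Ext groups of $\mathcal A$ if $f_{n,A,B}$ is an isomorphism for all $A,B\in\mathcal A$ and all $n\in\mathbb N$. **Proposition.** Let $\mathcal T$ be a realized triangulated category and let $\mathcal A$ be a heart on $\mathcal T$. Then a realization functor $\mathrm D^{\mathrm b}(\mathcal A)\to\mathcal T$ exists, and for every realization functor $\mathsf{real}\colon\mathrm D^{\mathrm b}(\mathcal A)\to\mathcal T$ the following are equivalent: 1. $\mathcal T$ has all the Ext groups of $\mathcal A$; 2. $\mathsf{real}$ is fully faithful; 3. $\mathsf{real}$ is full.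 Moreover, if these conditions hold, then $\mathsf{real}$ is an exact equivalence. -/

import Mathlib

open CategoryTheory CategoryTheory.Limits CategoryTheory.Pretriangulated
  CategoryTheory.Triangulated CategoryTheory.Abelian

universe v u

namespace HeartRealization

section Eff
universe w
variable {C : Type u} [Category.{v} C] [Abelian C] [HasExt.{w} C]

/-- Every class in `Extⁿ⁺¹(A, B)` is killed by pulling back along some epimorphism `P ⟶ A`. -/
lemma exists_epi_comp_eq_zero {A B : C} {n : ℕ} (x : Ext A B (n + 1)) :
    ∃ (P : C) (p : P ⟶ A), Epi p ∧ (Ext.mk₀ p).comp x (zero_add (n + 1)) = 0 := by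
  let := HasDerivedCategory.standard C
  let e := ((DerivedCategory.singleFunctors C).shiftIso ((n + 1 : ℕ) : ℤ) (-((n + 1 : ℕ) : ℤ)) 0
    (by lia)).app B
  let f : DerivedCategory.Q.obj ((CochainComplex.singleFunctor C 0).obj A) ⟶
      DerivedCategory.Q.obj ((CochainComplex.singleFunctor C (-((n + 1 : ℕ) : ℤ))).obj B) :=
    x.hom ≫ e.hom
  obtain ⟨X', hX', s, hs, g, fac⟩ := DerivedCategory.right_fac_of_isStrictlyLE f 0
  let Y := (CochainComplex.singleFunctor C 0).obj A
  have hd : X'.d 0 1 = 0 := (X'.isZero_of_isStrictlyLE 0 1 (by lia)).eq_of_tgt _ _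
  have hY : IsZero (Y.X (-1)) := HomologicalComplex.isZero_single_obj_X _ _ _ _ (by lia)
  have hY' : IsZero (Y.X 1) := HomologicalComplex.isZero_single_obj_X _ _ _ _ (by lia)
  have i1 : IsIso (Y.homologyπ 0) := Y.isIso_homologyπ (-1) 0 (by simp) (hY.eq_of_src _ _)
  have i2 : IsIso (Y.iCycles 0) := Y.isIso_iCycles 0 1 (by simp) (hY'.eq_of_tgt _ _)
  have qs : QuasiIso s := by rwa [← DerivedCategory.isIso_Q_map_iff_quasiIso]
  have hep : Epi (s.f 0) := by
    have h1 : Epi (HomologicalComplex.cyclesMap s 0 ≫ Y.homologyπ 0) := by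
      rw [← HomologicalComplex.homologyπ_naturality]
      infer_instance
    have h2 : Epi (HomologicalComplex.cyclesMap s 0) := by
      have := epi_comp (HomologicalComplex.cyclesMap s 0 ≫ Y.homologyπ 0) (inv (Y.homologyπ 0))
      simpa using this
    have h3 : Epi (X'.iCycles 0 ≫ s.f 0) := by
      rw [← HomologicalComplex.cyclesMap_i]
      infer_instance
    exact epi_of_epi (X'.iCycles 0) (s.f 0)
  let eA : Y.X 0 ≅ A := HomologicalComplex.singleObjXSelf (ComplexShape.up ℤ) 0 A
  let j : (CochainComplex.singleFunctor C 0).obj (X'.X 0) ⟶ X' :=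
    HomologicalComplex.mkHomFromSingle (𝟙 _) (by
      intro k hk
      obtain rfl : k = 1 := by simpa using hk.symm
      simp [hd])
  refine ⟨X'.X 0, s.f 0 ≫ eA.hom, inferInstance, ?_⟩
  have hjs : j ≫ s = (CochainComplex.singleFunctor C 0).map (s.f 0 ≫ eA.hom) := by
    apply HomologicalComplex.from_single_hom_ext
    have e1 := HomologicalComplex.single_map_f_self (ComplexShape.up ℤ) 0 (s.f 0 ≫ eA.hom)
    have e2 : j.f 0 = (HomologicalComplex.singleObjXSelf (ComplexShape.up ℤ) 0 (X'.X 0)).hom ≫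
        𝟙 _ := HomologicalComplex.mkHomFromSingle_f _ _
    have e3 : (s.f 0 ≫ eA.hom) ≫ eA.inv = s.f 0 := by simp
    refine Eq.trans ?_ e1.symm
    rw [HomologicalComplex.comp_f, e2, Category.comp_id]
    exact congrArg (fun z => _ ≫ z) e3.symm
  have hjg : j ≫ g = 0 := by
    ext i
    by_cases hi : i = 0
    · subst hi
      exact (HomologicalComplex.isZero_single_obj_X _ _ _ _ (by lia)).eq_of_tgt _ _
    · exact (HomologicalComplex.isZero_single_obj_X _ _ _ _ hi).eq_of_src _ _
  ext
  have key : (DerivedCategory.singleFunctor C 0).map (s.f 0 ≫ eA.hom) ≫ x.hom ≫ e.hom = 0 := by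
    change DerivedCategory.Q.map ((CochainComplex.singleFunctor C 0).map (s.f 0 ≫ eA.hom)) ≫ f = 0
    rw [fac, ← hjs, Functor.map_comp, Category.assoc, IsIso.hom_inv_id_assoc, ← Functor.map_comp,
      hjg, Functor.map_zero]
  rw [Ext.comp_hom, Ext.mk₀_hom, ShiftedHom.mk₀_comp, Ext.zero_hom, ← cancel_mono e.hom,
    Category.assoc]
  exact key.trans zero_comp.symm

end Eff

section Heart

variable {T : Type u} [Category.{v} T] [Preadditive T] [HasZeroObject T] [HasShift T ℤ]
  [∀ n : ℤ, (shiftFunctor T n).Additive] [Pretriangulated T] (t : TStructure T)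

/-- A t-structure is bounded if every object `X` lies in `T^{≤ b} ∩ T^{≥ a}` for some integers
`a` and `b`. -/
def IsBounded : Prop := ∀ X : T, t.bounded X

instance isLE_heart (A : t.heart.FullSubcategory) : t.IsLE A.obj 0 := ⟨A.property.1⟩

instance isGE_heart (A : t.heart.FullSubcategory) : t.IsGE A.obj 0 := ⟨A.property.2⟩

instance containsZero_heart : t.heart.ContainsZero where
  exists_zero := ⟨_, isZero_zero T, (t.mem_heart_iff _).2
    ⟨t.isLE_of_isZero (isZero_zero T) 0, t.isGE_of_isZero (isZero_zero T) 0⟩⟩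

instance binaryProducts_heart : t.heart.IsClosedUnderBinaryProducts where
  limitsOfShape_le := by
    rintro X ⟨p⟩
    have h₁ := (t.mem_heart_iff _).1 (p.prop_diag_obj (.mk .left))
    have h₂ := (t.mem_heart_iff _).1 (p.prop_diag_obj (.mk .right))
    refine t.heart.prop_of_iso ?_ ((t.mem_heart_iff _).2
      ⟨t.isLE₂ _ (binaryProductTriangle_distinguished (p.diag.obj (.mk .left))
          (p.diag.obj (.mk .right))) 0 h₁.1 h₂.1,
        t.isGE₂ _ (binaryProductTriangle_distinguished (p.diag.obj (.mk .left))
          (p.diag.obj (.mk .right))) 0 h₁.2 h₂.2⟩)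
    exact IsLimit.conePointUniqueUpToIso (prodIsProd _ _)
      ((IsLimit.postcomposeHomEquiv (diagramIsoPair p.diag) _).2 p.isLimit)

instance finiteProducts_heart : t.heart.IsClosedUnderFiniteProducts := .mk'

lemma hom_shift_eq_zero ⦃X Y : t.heart.FullSubcategory⦄ ⦃n : ℤ⦄
    (f : t.heart.ι.obj X ⟶ (t.heart.ι.obj Y)⟦n⟧) (hn : n < 0) : f = 0 := by
  have : t.IsLE (t.heart.ι.obj X) 0 := isLE_heart t X
  have : t.IsGE (t.heart.ι.obj Y) 0 := isGE_heart t Y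
  have : t.IsGE ((t.heart.ι.obj Y)⟦n⟧) (-n) := t.isGE_shift _ 0 n (-n)
  exact t.zero f 0 (-n)

lemma admissible_heart [IsTriangulated T] :
    AbelianSubcategory.admissibleMorphism t.heart.ι = ⊤ := by
  ext X₁ X₂ f₁
  simp only [MorphismProperty.top_apply, iff_true]
  intro X₃ f₂ f₃ hT
  have : t.IsLE (t.heart.ι.obj X₁) 0 := isLE_heart t X₁
  have : t.IsGE (t.heart.ι.obj X₁) 0 := isGE_heart t X₁
  have hX₂ : t.IsLE (t.heart.ι.obj X₂) 0 := isLE_heart t X₂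
  have hX₂' : t.IsGE (t.heart.ι.obj X₂) 0 := isGE_heart t X₂
  have h₁ : t.IsLE ((t.heart.ι.obj X₁)⟦(1 : ℤ)⟧) (-1) := t.isLE_shift _ 0 1 (-1)
  have h₂ : t.IsGE ((t.heart.ι.obj X₁)⟦(1 : ℤ)⟧) (-1) := t.isGE_shift _ 0 1 (-1)
  have h₁' : t.IsLE ((t.heart.ι.obj X₁)⟦(1 : ℤ)⟧) 0 := t.isLE_of_le _ (-1) 0
  have hX₂'' : t.IsGE (t.heart.ι.obj X₂) (-1) := t.isGE_of_ge _ (-1) 0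
  have : t.IsLE X₃ 0 := t.isLE₂ _ (rot_of_distTriang _ hT) 0 hX₂ h₁'
  have : t.IsGE X₃ (-1) := t.isGE₂ _ (rot_of_distTriang _ hT) (-1) hX₂'' h₂
  let L := (t.truncLE (-1)).obj X₃
  have hL₁ : t.IsLE (L⟦(-1 : ℤ)⟧) 0 := t.isLE_shift L (-1) (-1) 0
  have hL₂ : t.IsGE (L⟦(-1 : ℤ)⟧) 0 := t.isGE_shift L (-1) (-1) 0
  let Q := (t.truncGE 0).obj X₃
  let K : t.heart.FullSubcategory := ⟨L⟦(-1 : ℤ)⟧, (t.mem_heart_iff _).2 ⟨hL₁, hL₂⟩⟩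
  let Q' : t.heart.FullSubcategory := ⟨Q, (t.mem_heart_iff _).2 ⟨inferInstance, inferInstance⟩⟩
  let e : (t.heart.ι.obj K)⟦(1 : ℤ)⟧ ≅ L :=
    (shiftFunctorCompIsoId T (-1 : ℤ) 1 (by lia)).app L
  let α : (t.heart.ι.obj K)⟦(1 : ℤ)⟧ ⟶ X₃ := e.hom ≫ (t.truncLEι (-1)).app X₃
  let β : X₃ ⟶ t.heart.ι.obj Q' := (t.truncGEπ 0).app X₃
  let δ : Q ⟶ L⟦(1 : ℤ)⟧ := (t.truncGEδLE (-1) 0 (by lia)).app X₃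
  have hd : Triangle.mk ((t.truncLEι (-1)).app X₃) β δ ∈ distTriang T :=
    t.triangleLEGE_distinguished (-1) 0 (by lia) X₃
  have h : (δ ≫ e.inv⟦(1 : ℤ)⟧') ≫ e.hom⟦(1 : ℤ)⟧' = 𝟙 Q ≫ δ := by
    rw [Category.assoc, ← Functor.map_comp, e.inv_hom_id, CategoryTheory.Functor.map_id, Category.comp_id,
      Category.id_comp]
  exact ⟨K, Q', α, β, δ ≫ e.inv⟦(1 : ℤ)⟧', isomorphic_distinguished _ hd _
    (Triangle.isoMk _ _ e (Iso.refl _) (Iso.refl _) (Category.comp_id α)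
      ((Category.comp_id β).trans (Category.id_comp β).symm) h)⟩

variable {t} in
lemma connecting_naturality {S S' : ShortComplex t.heart.FullSubcategory} [Epi S.g]
    (φ : S ⟶ S')
    {d : t.heart.ι.obj S.X₃ ⟶ (t.heart.ι.obj S.X₁)⟦(1 : ℤ)⟧}
    {d' : t.heart.ι.obj S'.X₃ ⟶ (t.heart.ι.obj S'.X₁)⟦(1 : ℤ)⟧}
    (hd : Triangle.mk (t.heart.ι.map S.f) (t.heart.ι.map S.g) d ∈ distTriang T)
    (hd' : Triangle.mk (t.heart.ι.map S'.f) (t.heart.ι.map S'.g) d' ∈ distTriang T) :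
    d ≫ (t.heart.ι.map φ.τ₁)⟦(1 : ℤ)⟧' = t.heart.ι.map φ.τ₃ ≫ d' := by
  obtain ⟨c, hc₁, hc₂⟩ := complete_distinguished_triangle_morphism _ _ hd hd'
    (t.heart.ι.map φ.τ₁) (t.heart.ι.map φ.τ₂)
    (show t.heart.ι.map S.f ≫ t.heart.ι.map φ.τ₂ = t.heart.ι.map φ.τ₁ ≫ t.heart.ι.map S'.f by
      rw [← Functor.map_comp, ← Functor.map_comp, φ.comm₁₂])
  obtain ⟨c', rfl⟩ := t.heart.ι.map_surjective
    (show t.heart.ι.obj S.X₃ ⟶ t.heart.ι.obj S'.X₃ from c)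
  have hc₁' : t.heart.ι.map S.g ≫ t.heart.ι.map c' =
      t.heart.ι.map φ.τ₂ ≫ t.heart.ι.map S'.g := hc₁
  obtain rfl : c' = φ.τ₃ := by
    rw [← cancel_epi S.g, ← φ.comm₂₃]
    apply t.heart.ι.map_injective
    rw [Functor.map_comp, Functor.map_comp, hc₁']
  exact hc₂

/-- The heart of a t-structure is an abelian category. -/
noncomputable instance abelianHeart [IsTriangulated T] : Abelian t.heart.FullSubcategory :=
  AbelianSubcategory.abelian t.heart.ι (hom_shift_eq_zero t) (admissible_heart t)

variable [IsTriangulated T]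

noncomputable instance hasDerivedCategoryHeart :
    HasDerivedCategory.{max u v} t.heart.FullSubcategory :=
  HasDerivedCategory.standard _

instance hasExtHeart : HasExt.{max u v} t.heart.FullSubcategory := HasExt.standard _

variable {t}

/-- A short exact sequence `0 → X₁ → X₂ → X₃ → 0` in the heart extends uniquely to a
distinguished triangle `X₁ → X₂ → X₃ → X₁[1]`. -/
lemma existsUnique_connecting {S : ShortComplex t.heart.FullSubcategory} (hS : S.ShortExact) :
    ∃! d : t.heart.ι.obj S.X₃ ⟶ (t.heart.ι.obj S.X₁)⟦(1 : ℤ)⟧,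
      Triangle.mk (t.heart.ι.map S.f) (t.heart.ι.map S.g) d ∈ distTriang T := by
  refine existsUnique_of_exists_of_unique ?_ ?_
  · have := hS.epi_g
    obtain ⟨K, i, d, hT⟩ := AbelianSubcategory.exists_distinguished_triangle_of_epi
      (hom_shift_eq_zero t) (admissible_heart t) S.g
    let lim := AbelianSubcategory.isLimitKernelForkOfDistTriang (hom_shift_eq_zero t) i S.g d hT
    let e : S.X₁ ≅ K := IsLimit.conePointUniqueUpToIso hS.fIsKernel lim
    have he : e.hom ≫ i = S.f :=
      IsLimit.conePointUniqueUpToIso_hom_comp hS.fIsKernel lim WalkingParallelPair.zero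
    let E := t.heart.ι.mapIso e
    have h1 : t.heart.ι.map S.f ≫ 𝟙 _ = E.hom ≫ t.heart.ι.map i := by
      rw [Category.comp_id, ← he, Functor.map_comp]; rfl
    have h3 : (d ≫ E.inv⟦(1 : ℤ)⟧') ≫ E.hom⟦(1 : ℤ)⟧' = 𝟙 _ ≫ d := by
      rw [Category.assoc, ← Functor.map_comp, E.inv_hom_id, CategoryTheory.Functor.map_id,
        Category.comp_id, Category.id_comp]
    exact ⟨d ≫ E.inv⟦(1 : ℤ)⟧', isomorphic_distinguished _ hT _
      (Triangle.isoMk _ _ E (Iso.refl _) (Iso.refl _) h1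
        ((Category.comp_id _).trans (Category.id_comp _).symm) h3)⟩
  · intro d d' hd hd'
    have := hS.epi_g
    have h := connecting_naturality (𝟙 S) hd hd'
    rw [ShortComplex.id_τ₁, ShortComplex.id_τ₃, CategoryTheory.Functor.map_id,
      CategoryTheory.Functor.map_id, CategoryTheory.Functor.map_id] at h
    exact (Category.comp_id d).symm.trans (h.trans (Category.id_comp d'))

/-- The connecting morphism `X₃ → X₁[1]` in `T` of a short exact sequence
`0 → X₁ → X₂ → X₃ → 0` in the heart. -/
noncomputable def connecting {S : ShortComplex t.heart.FullSubcategory} (hS : S.ShortExact) :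
    ShiftedHom (t.heart.ι.obj S.X₃) (t.heart.ι.obj S.X₁) (1 : ℤ) :=
  (existsUnique_connecting hS).choose

lemma connecting_distinguished {S : ShortComplex t.heart.FullSubcategory} (hS : S.ShortExact) :
    Triangle.mk (t.heart.ι.map S.f) (t.heart.ι.map S.g) (connecting hS) ∈ distTriang T :=
  (existsUnique_connecting hS).choose_spec.1

/-- `IsComposite n x α` says that the class `x` of `Extⁿ(A, B)` is the Yoneda product of the
classes of short exact sequences `0 → Cᵢ₋₁ → Xᵢ → Cᵢ → 0` (with `C₀ = B` and `Cₙ = A`), i.e. the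
class of an `n`-extension `0 → B → X₁ → ⋯ → Xₙ → A → 0`, and that `α` is the composite
`A → Cₙ₋₁[1] → ⋯ → C₁[n-1] → B[n]` of the connecting morphisms of these sequences in `T`.
For `n = 0`, it says that `x` and `α` come from the same morphism of the heart. -/
def IsComposite : ∀ (n : ℕ) {A B : t.heart.FullSubcategory}, Ext.{max u v} A B n →
    ShiftedHom (t.heart.ι.obj A) (t.heart.ι.obj B) (n : ℤ) → Prop
  | 0, A, B, x, α => ∃ g : A ⟶ B, x = Ext.mk₀ g ∧
      α = ShiftedHom.mk₀ ((0 : ℕ) : ℤ) (by simp) (t.heart.ι.map g)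
  | n + 1, A, B, x, α => ∃ (K X : t.heart.FullSubcategory) (i : K ⟶ X) (p : X ⟶ A) (w : i ≫ p = 0)
      (hS : (ShortComplex.mk i p w).ShortExact) (y : Ext.{max u v} K B n)
      (β : ShiftedHom (t.heart.ι.obj K) (t.heart.ι.obj B) (n : ℤ)),
      IsComposite n y β ∧ x = hS.extClass.comp y (add_comm 1 n) ∧
        α = (connecting hS).comp β (by push_cast; ring)

section Comparison

/-- An additive family of maps `Extⁿ(A, B) → Hom(A, B[n])`, natural in `A`, whose graph
is the relation `IsComposite n`. -/
structure GraphMap (t : TStructure T) (n : ℕ) where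
  map : ∀ A B : t.heart.FullSubcategory, Ext.{max u v} A B n →+
    ShiftedHom (t.heart.ι.obj A) (t.heart.ι.obj B) (n : ℤ)
  map_precomp : ∀ {A' A B : t.heart.FullSubcategory} (g : A' ⟶ A) (x : Ext.{max u v} A B n),
    map A' B ((Ext.mk₀ g).comp x (zero_add n)) = t.heart.ι.map g ≫ map A B x
  graph : ∀ {A B : t.heart.FullSubcategory} (x : Ext.{max u v} A B n)
    (α : ShiftedHom (t.heart.ι.obj A) (t.heart.ι.obj B) (n : ℤ)),
    IsComposite n x α ↔ α = map A B x

lemma GraphMap.nonempty_zero : Nonempty (GraphMap t 0) := by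
  let f (A B : t.heart.FullSubcategory) : Ext.{max u v} A B 0 →+
      ShiftedHom (t.heart.ι.obj A) (t.heart.ι.obj B) ((0 : ℕ) : ℤ) :=
    AddMonoidHom.mk' (fun x => ShiftedHom.mk₀ ((0 : ℕ) : ℤ) (by simp)
      (t.heart.ι.map (Ext.addEquiv₀ x))) (fun x y => by
        rw [map_add, Functor.map_add, ShiftedHom.mk₀_add])
  have hf {A B : t.heart.FullSubcategory} (g : A ⟶ B) : f A B (Ext.mk₀ g) =
      ShiftedHom.mk₀ ((0 : ℕ) : ℤ) (by simp) (t.heart.ι.map g) := by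
    have : Ext.addEquiv₀ (Ext.mk₀ g) = g := Ext.addEquiv₀.apply_symm_apply g
    simp only [f, AddMonoidHom.mk'_apply, this]
  have hs {A B : t.heart.FullSubcategory} (x : Ext.{max u v} A B 0) :
      ∃ g, x = Ext.mk₀ g := ⟨Ext.addEquiv₀ x, (Ext.addEquiv₀.symm_apply_apply x).symm⟩
  refine ⟨⟨f, ?_, ?_⟩⟩
  · intro A' A B g x
    obtain ⟨h, rfl⟩ := hs x
    rw [Ext.mk₀_comp_mk₀, hf, hf, Functor.map_comp]
    simp [ShiftedHom.mk₀]
  · intro A B x α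
    constructor
    · rintro ⟨g, rfl, rfl⟩
      rw [hf]
    · rintro rfl
      obtain ⟨g, rfl⟩ := hs x
      exact ⟨g, rfl, hf g⟩

variable {n : ℕ} (F : GraphMap t n)

/-- `x` and `α` are represented by a class `y` and the short exact sequence `S`. -/
def GraphMap.Rep {S : ShortComplex t.heart.FullSubcategory} (hS : S.ShortExact)
    {B : t.heart.FullSubcategory} (x : Ext.{max u v} S.X₃ B (n + 1))
    (α : ShiftedHom (t.heart.ι.obj S.X₃) (t.heart.ι.obj B) ((n + 1 : ℕ) : ℤ)) : Prop :=
  ∃ y : Ext.{max u v} S.X₁ B n, x = hS.extClass.comp y (add_comm 1 n) ∧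
    α = (connecting hS).comp (F.map _ _ y) (by push_cast; ring)

lemma GraphMap.Rep.precomp {S S' : ShortComplex t.heart.FullSubcategory} {hS : S.ShortExact}
    (hS' : S'.ShortExact) (φ : S' ⟶ S)
    {B : t.heart.FullSubcategory} {x : Ext.{max u v} S.X₃ B (n + 1)}
    {α : ShiftedHom (t.heart.ι.obj S.X₃) (t.heart.ι.obj B) ((n + 1 : ℕ) : ℤ)}
    (h : F.Rep hS x α) :
    F.Rep hS' ((Ext.mk₀ φ.τ₃).comp x (zero_add (n + 1))) (t.heart.ι.map φ.τ₃ ≫ α) := by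
  obtain ⟨y, rfl, rfl⟩ := h
  refine ⟨(Ext.mk₀ φ.τ₁).comp y (zero_add n), ?_, ?_⟩
  · rw [← Ext.comp_assoc (a₁₂ := 1) _ _ _ (add_zero 1) _ (by lia),
      ShortComplex.ShortExact.extClass_naturality hS' hS φ,
      Ext.comp_assoc (a₂₃ := n + 1) _ _ _ _ _ (by lia)]
  · have := hS'.epi_g
    have h := connecting_naturality φ (connecting_distinguished hS')
      (connecting_distinguished hS)
    rw [F.map_precomp]
    simp only [ShiftedHom.comp, Functor.map_comp, Category.assoc]
    exact ((Category.assoc _ _ _).symm.trans (congrArg (fun z => z ≫ _) h)).trans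
      (Category.assoc _ _ _) |>.symm

lemma GraphMap.Rep.eq_zero {S : ShortComplex t.heart.FullSubcategory} {hS : S.ShortExact}
    {B : t.heart.FullSubcategory}
    {α : ShiftedHom (t.heart.ι.obj S.X₃) (t.heart.ι.obj B) ((n + 1 : ℕ) : ℤ)}
    (h : F.Rep hS 0 α) : α = 0 := by
  obtain ⟨y, hy, rfl⟩ := h
  obtain ⟨z, rfl⟩ := Ext.contravariant_sequence_exact₁ hS B y (add_comm 1 n) hy.symm
  have h : connecting hS ≫ (t.heart.ι.map S.f)⟦(1 : ℤ)⟧' = 0 :=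
    comp_distTriang_mor_zero₃₁ _ (connecting_distinguished hS)
  rw [F.map_precomp, ShiftedHom.comp, Functor.map_comp, Category.assoc]
  exact (Category.assoc _ _ _).symm.trans ((congrArg (fun z => z ≫ _) h).trans zero_comp)

lemma GraphMap.exists_rep_of_epi {P A B : t.heart.FullSubcategory} (p : P ⟶ A) [Epi p]
    (x : Ext.{max u v} A B (n + 1)) (hx : (Ext.mk₀ p).comp x (zero_add (n + 1)) = 0)
    (hS : (ShortComplex.mk (kernel.ι p) p (kernel.condition p)).ShortExact) :
    ∃ α, F.Rep hS x α := by
  obtain ⟨y, hy⟩ := Ext.contravariant_sequence_exact₃ hS B x hx (add_comm 1 n)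
  exact ⟨_, y, hy.symm, rfl⟩

lemma shortExact_kernel {P A : t.heart.FullSubcategory} (p : P ⟶ A) [Epi p] :
    (ShortComplex.mk (kernel.ι p) p (kernel.condition p)).ShortExact where
  exact := ShortComplex.exact_of_f_is_kernel _ (kernelIsKernel p)

lemma GraphMap.Rep.of_epi {K X A B : t.heart.FullSubcategory} {i : K ⟶ X} {p : X ⟶ A}
    {w : i ≫ p = 0} {hS : (ShortComplex.mk i p w).ShortExact}
    {x : Ext.{max u v} A B (n + 1)}
    {α : ShiftedHom (t.heart.ι.obj A) (t.heart.ι.obj B) ((n + 1 : ℕ) : ℤ)}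
    (h : F.Rep hS x α) {A' P : t.heart.FullSubcategory} (g : A' ⟶ A) (q : P ⟶ A') [Epi q]
    (r : P ⟶ X) (hr : r ≫ p = q ≫ g) :
    F.Rep (shortExact_kernel q) ((Ext.mk₀ g).comp x (zero_add (n + 1)))
      (t.heart.ι.map g ≫ α) := by
  have := hS.mono_f
  let l : kernel q ⟶ K := hS.exact.lift (kernel.ι q ≫ r) (by
    simp [hr])
  have hl : l ≫ i = kernel.ι q ≫ r := hS.exact.lift_f _ _
  let φ : ShortComplex.mk (kernel.ι q) q (kernel.condition q) ⟶ ShortComplex.mk i p w :=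
    ShortComplex.Hom.mk l r g hl hr
  exact GraphMap.Rep.precomp F (hS := hS) (shortExact_kernel q) φ h

/-- The relation on `Extⁿ⁺¹(A, B) × Hom(A, B[n+1])` induced by `F`. -/
def GraphMap.Succ {A B : t.heart.FullSubcategory} (x : Ext.{max u v} A B (n + 1))
    (α : ShiftedHom (t.heart.ι.obj A) (t.heart.ι.obj B) ((n + 1 : ℕ) : ℤ)) : Prop :=
  ∃ (P : t.heart.FullSubcategory) (p : P ⟶ A) (_ : Epi p), F.Rep (shortExact_kernel p) x α

lemma GraphMap.Rep.succ {K X A B : t.heart.FullSubcategory} {i : K ⟶ X} {p : X ⟶ A}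
    {w : i ≫ p = 0} {hS : (ShortComplex.mk i p w).ShortExact}
    {x : Ext.{max u v} A B (n + 1)}
    {α : ShiftedHom (t.heart.ι.obj A) (t.heart.ι.obj B) ((n + 1 : ℕ) : ℤ)}
    (h : F.Rep hS x α) : F.Succ x α := by
  have : Epi p := hS.epi_g
  have := h.of_epi F (𝟙 A) p (𝟙 X) (by simp)
  rw [Ext.mk₀_id_comp, CategoryTheory.Functor.map_id, Category.id_comp] at this
  exact ⟨X, p, ‹_›, this⟩

lemma GraphMap.Succ.precomp {A B : t.heart.FullSubcategory} {x : Ext.{max u v} A B (n + 1)}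
    {α : ShiftedHom (t.heart.ι.obj A) (t.heart.ι.obj B) ((n + 1 : ℕ) : ℤ)}
    (h : F.Succ x α) {A' : t.heart.FullSubcategory} (g : A' ⟶ A) :
    F.Succ ((Ext.mk₀ g).comp x (zero_add (n + 1))) (t.heart.ι.map g ≫ α) := by
  obtain ⟨P, p, _, h⟩ := h
  exact ⟨_, pullback.snd p g, inferInstance,
    h.of_epi F g (pullback.snd p g) (pullback.fst p g) pullback.condition⟩

lemma GraphMap.Succ.add {A B : t.heart.FullSubcategory} {x₁ x₂ : Ext.{max u v} A B (n + 1)}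
    {α₁ α₂ : ShiftedHom (t.heart.ι.obj A) (t.heart.ι.obj B) ((n + 1 : ℕ) : ℤ)}
    (h₁ : F.Succ x₁ α₁) (h₂ : F.Succ x₂ α₂) : F.Succ (x₁ + x₂) (α₁ + α₂) := by
  obtain ⟨P₁, p₁, _, h₁⟩ := h₁
  obtain ⟨P₂, p₂, _, h₂⟩ := h₂
  have h₁ := h₁.of_epi F (𝟙 A) (pullback.fst p₁ p₂ ≫ p₁) (pullback.fst p₁ p₂) (by simp)
  have h₂ := h₂.of_epi F (𝟙 A) (pullback.fst p₁ p₂ ≫ p₁) (pullback.snd p₁ p₂)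
    (by simp [pullback.condition])
  rw [Ext.mk₀_id_comp, CategoryTheory.Functor.map_id, Category.id_comp] at h₁ h₂
  obtain ⟨y₁, rfl, rfl⟩ := h₁
  obtain ⟨y₂, rfl, rfl⟩ := h₂
  refine ⟨_, pullback.fst p₁ p₂ ≫ p₁, inferInstance, y₁ + y₂, ?_, ?_⟩
  · rw [Ext.comp_add]
  · rw [map_add, ShiftedHom.comp_add]

lemma GraphMap.Succ.neg {A B : t.heart.FullSubcategory} {x : Ext.{max u v} A B (n + 1)}
    {α : ShiftedHom (t.heart.ι.obj A) (t.heart.ι.obj B) ((n + 1 : ℕ) : ℤ)}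
    (h : F.Succ x α) : F.Succ (-x) (-α) := by
  obtain ⟨P, p, _, y, rfl, rfl⟩ := h
  refine ⟨P, p, inferInstance, -y, ?_, ?_⟩
  · rw [Ext.comp_neg]
  · rw [map_neg, ShiftedHom.comp_neg]

lemma GraphMap.Succ.eq_zero {A B : t.heart.FullSubcategory}
    {α : ShiftedHom (t.heart.ι.obj A) (t.heart.ι.obj B) ((n + 1 : ℕ) : ℤ)}
    (h : F.Succ (0 : Ext.{max u v} A B (n + 1)) α) : α = 0 := by
  obtain ⟨P, p, _, h⟩ := h
  exact h.eq_zero F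

lemma GraphMap.Succ.unique {A B : t.heart.FullSubcategory} {x : Ext.{max u v} A B (n + 1)}
    {α₁ α₂ : ShiftedHom (t.heart.ι.obj A) (t.heart.ι.obj B) ((n + 1 : ℕ) : ℤ)}
    (h₁ : F.Succ x α₁) (h₂ : F.Succ x α₂) : α₁ = α₂ := by
  have h := h₁.add F (h₂.neg F)
  rw [add_neg_cancel] at h
  exact add_neg_eq_zero.1 (h.eq_zero F)

lemma GraphMap.exists_succ {A B : t.heart.FullSubcategory} (x : Ext.{max u v} A B (n + 1)) :
    ∃ α, F.Succ x α := by
  obtain ⟨P, p, _, h⟩ := exists_epi_comp_eq_zero x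
  obtain ⟨α, hα⟩ := F.exists_rep_of_epi p x h (shortExact_kernel p)
  exact ⟨α, P, p, ‹_›, hα⟩

lemma GraphMap.succ_iff {A B : t.heart.FullSubcategory} (x : Ext.{max u v} A B (n + 1))
    (α : ShiftedHom (t.heart.ι.obj A) (t.heart.ι.obj B) ((n + 1 : ℕ) : ℤ)) :
    IsComposite (n + 1) x α ↔ F.Succ x α := by
  constructor
  · rintro ⟨K, X, i, p, w, hS, y, β, h, rfl, rfl⟩
    obtain rfl := (F.graph _ _).1 h
    exact GraphMap.Rep.succ (hS := hS) F ⟨y, rfl, rfl⟩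
  · rintro ⟨P, p, _, y, rfl, rfl⟩
    exact ⟨_, P, _, p, _, shortExact_kernel p, y, _, (F.graph _ _).2 rfl, rfl, rfl⟩

lemma GraphMap.nonempty_succ (F : GraphMap t n) : Nonempty (GraphMap t (n + 1)) := by
  choose f hf using fun (A B : t.heart.FullSubcategory) (x : Ext.{max u v} A B (n + 1)) =>
    F.exists_succ x
  refine ⟨⟨fun A B => AddMonoidHom.mk' (f A B) (fun x y => ?_), fun {A' A B} g x => ?_,
    fun {A B} x α => ?_⟩⟩
  · exact (hf A B (x + y)).unique F ((hf A B x).add F (hf A B y))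
  · exact (hf A' B _).unique F ((hf A B x).precomp F g)
  · rw [F.succ_iff]
    exact ⟨fun h => h.unique F (hf A B x), by rintro rfl; exact hf A B x⟩

variable (t) in
lemma GraphMap.nonempty (n : ℕ) : Nonempty (GraphMap t n) := by
  induction n with
  | zero => exact GraphMap.nonempty_zero
  | succ n hn => exact hn.some.nonempty_succ

end Comparison

/-- The canonical map `Extⁿ(A, B) → Hom(A, B[n])`, sending the class of an `n`-extension of
`A` by `B` to the composite of the connecting morphisms of the short exact sequences into which
it splits. -/
noncomputable def extComparison (n : ℕ) (A B : t.heart.FullSubcategory) :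
    Ext.{max u v} A B n →+ ShiftedHom (t.heart.ι.obj A) (t.heart.ι.obj B) (n : ℤ) :=
  (GraphMap.nonempty t n).some.map A B

/-- `extComparison` is the map whose graph is `IsComposite`. -/
lemma isComposite_iff {n : ℕ} {A B : t.heart.FullSubcategory} (x : Ext.{max u v} A B n)
    (α : ShiftedHom (t.heart.ι.obj A) (t.heart.ι.obj B) (n : ℤ)) :
    IsComposite n x α ↔ α = extComparison n A B x :=
  (GraphMap.nonempty t n).some.graph x α

variable (t)

/-- `T` has all the Ext groups of the heart of `t`: the canonical maps
`Extⁿ(A, B) → Hom(A, B[n])` are isomorphisms. -/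
def HasAllExt : Prop :=
  ∀ (n : ℕ) (A B : t.heart.FullSubcategory), Function.Bijective (extComparison n A B)

/-- The embedding `𝒜 ⥤ D^b(𝒜)` of the heart as complexes concentrated in degree `0`. -/
noncomputable def heartToBounded :
    t.heart.FullSubcategory ⥤ DerivedCategory.Bounded t.heart.FullSubcategory :=
  DerivedCategory.TStructure.t.bounded.lift
    (DerivedCategory.singleFunctor t.heart.FullSubcategory 0)
    (fun _ => ⟨⟨0, inferInstance⟩, ⟨0, inferInstance⟩⟩)

/-- A realization functor for the heart `𝒜` of `t`: an exact functor `D^b(𝒜) ⥤ T` whose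
restriction to `𝒜` is the inclusion. -/
structure RealizationFunctor where
  functor : DerivedCategory.Bounded t.heart.FullSubcategory ⥤ T
  commShift : functor.CommShift ℤ
  isTriangulated : functor.IsTriangulated
  iso : heartToBounded t ⋙ functor ≅ t.heart.ι

attribute [instance] RealizationFunctor.commShift RealizationFunctor.isTriangulated

variable (T) in
/-- `T` is realized: for every full triangulated subcategory `S` of `T` and every heart `𝒜` of
a bounded t-structure on `S`, there is a realization functor `D^b(𝒜) ⥤ S`. -/
def IsRealized : Prop :=
  ∀ (P : ObjectProperty T) [P.IsTriangulated] (s : TStructure P.FullSubcategory),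
    IsBounded s → Nonempty (RealizationFunctor s)

end Heart

end HeartRealization

/-! Under the identification of `Extⁿ(A, B)` with `Hom(A, B[n])` in `D^b(𝒜)`, the canonical maps are
the action of `real` (`extComparison_eq`): both are multiplicative, they agree on morphisms of the
heart, and an exact functor carries the triangle of a short exact sequence to one with the unique
connecting morphism. So having all Ext groups means that `real` is bijective on `Hom(A, B[n])` for
`A`, `B` in the heart and `n ≥ 0` (`hasAllExt_iff`). For `n < 0` both sides vanish, and the five
lemma spreads bijectivity from shifts of the heart to all bounded objects
(`bijective_map_of_heart`). This gives full faithfulness.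

For the converse, `real` reflects zero objects: in an object killed by `real`, the image of the top
cohomology would be isomorphic to an object living in strictly lower degrees
(`isLE_functor_obj_and_isZero`). A full exact functor reflecting zero objects is faithful
(`faithful_of_full`), so fullness alone suffices.

When `real` is full, its essential image is a triangulated subcategory containing the heart, hence
everything, the t-structure being bounded. Existence comes from realizedness applied to the
subcategory of all objects, transported along the equivalence of hearts
(`RealizationFunctor.ofTop`). -/

namespace HeartRealization

/-! ### Bijectivity on morphisms under isomorphisms and shifts. -/

section ShiftCommutation

universe v₁ u₁ v₂ u₂

variable {C : Type u₁} [Category.{v₁} C] {D : Type u₂} [Category.{v₂} D] {F : C ⥤ D}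

lemma bijective_map_of_iso {X X' Y Y' : C} (e : X ≅ X') (e' : Y ≅ Y')
    (h : Function.Bijective (F.map : (X ⟶ Y) → _)) :
    Function.Bijective (F.map : (X' ⟶ Y') → _) := by
  constructor
  · intro f g hfg
    have : e.hom ≫ f ≫ e'.inv = e.hom ≫ g ≫ e'.inv := h.1 (by simp [hfg])
    simpa using this
  · intro f
    obtain ⟨g, hg⟩ := h.2 (F.map e.hom ≫ f ≫ F.map e'.inv)
    refine ⟨e.inv ≫ g ≫ e'.hom, ?_⟩
    simp [hg]

variable [HasShift C ℤ] [HasShift D ℤ] [F.CommShift ℤ]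

/-- Up to conjugation by the commutation isomorphisms, `F` acts on `f⟦n⟧'` as the shift of `F.map
f`, and shift functors are fully faithful. -/
lemma bijective_map_shift {X Y : C} (n : ℤ)
    (h : Function.Bijective (F.map : (X ⟶ Y) → _)) :
    Function.Bijective (F.map : (X⟦n⟧ ⟶ Y⟦n⟧) → _) := by
  have hc {A B : C} (f : A ⟶ B) : F.map (f⟦n⟧') = (F.commShiftIso n).hom.app A ≫
      (F.map f)⟦n⟧' ≫ (F.commShiftIso n).inv.app B := by
    have := F.commShiftIso_hom_naturality f n
    rw [← reassoc_of% this]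
    simp
  constructor
  · intro f g hfg
    obtain ⟨f, rfl⟩ := (shiftFunctor C n).map_surjective f
    obtain ⟨g, rfl⟩ := (shiftFunctor C n).map_surjective g
    rw [hc, hc, cancel_epi, cancel_mono] at hfg
    rw [h.1 ((shiftFunctor D n).map_injective hfg)]
  · intro f
    obtain ⟨g, hg⟩ := (shiftFunctor D n).map_surjective
      ((F.commShiftIso n).inv.app X ≫ f ≫ (F.commShiftIso n).hom.app Y)
    obtain ⟨g, rfl⟩ := h.2 g
    refine ⟨g⟦n⟧', ?_⟩
    rw [hc, hg]
    simp

lemma bijective_map_shift_right {X Y : C} (n : ℤ)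
    (h : Function.Bijective (F.map : (X⟦-n⟧ ⟶ Y) → _)) :
    Function.Bijective (F.map : (X ⟶ Y⟦n⟧) → _) :=
  bijective_map_of_iso ((shiftEquiv C n).counitIso.app X) (Iso.refl _) (bijective_map_shift n h)

lemma bijective_map_shift_left {X Y : C} (n : ℤ)
    (h : Function.Bijective (F.map : (X ⟶ Y⟦-n⟧) → _)) :
    Function.Bijective (F.map : (X⟦n⟧ ⟶ Y) → _) :=
  bijective_map_of_iso (Iso.refl _) ((shiftEquiv C n).counitIso.app Y) (bijective_map_shift n h)

end ShiftCommutation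

/-! ### Dévissage along bounded t-structures and the five lemma. -/

section Devissage

universe v₁ u₁ v₂ u₂

variable {C : Type u₁} [Category.{v₁} C] [Preadditive C] [HasZeroObject C] [HasShift C ℤ]
  [∀ n : ℤ, (shiftFunctor C n).Additive] [Pretriangulated C]
  {D : Type u₂} [Category.{v₂} D] [Preadditive D] [HasZeroObject D] [HasShift D ℤ]
  [∀ n : ℤ, (shiftFunctor D n).Additive] [Pretriangulated D]

/-- A strictly full triangulated subcategory which contains the heart of a t-structure contains
all bounded objects. -/
lemma prop_of_heart_le [IsTriangulated C] (t : TStructure C) (R : ObjectProperty C)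
    [R.IsTriangulated] [R.IsClosedUnderIsomorphisms] (hR : t.heart ≤ R) {X : C}
    (hX : t.bounded X) : R X := by
  -- Induction on the number `k` of degrees in `[a, a + k - 1]`. For `k = 0` the interval is empty
  -- and `X` is zero; otherwise truncation peels off the top degree.
  have key (k : ℕ) : ∀ (a : ℤ) (X : C), t.IsGE X a → t.IsLE X (a + k - 1) → R X := by
    induction k with
    | zero =>
      intro a X _ _
      exact R.prop_of_isZero (t.isZero X (a + (0 : ℕ) - 1) a (by lia))
    | succ k hk =>
      intro a X _ hX
      have hX : t.IsLE X (a + k) := by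
        rwa [show a + ((k + 1 : ℕ) : ℤ) - 1 = a + k by lia] at hX
      refine R.ext_of_isTriangulatedClosed₂ _
        (t.triangleLEGE_distinguished (a + k - 1) (a + k) (by lia) X) ?_ ?_
      · exact hk a ((t.truncLE (a + k - 1)).obj X) inferInstance inferInstance
      · let Y := (t.truncGE (a + k)).obj X
        -- The top piece is concentrated in degree `a + k`, so it is a shift of an object of the
        -- heart.
        have : R (Y⟦a + k⟧) := hR _ ((t.mem_heart_iff _).2
          ⟨t.isLE_shift Y (a + k) (a + k) 0, t.isGE_shift Y (a + k) (a + k) 0⟩)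
        exact R.prop_of_iso ((shiftEquiv C (a + k)).unitIso.symm.app Y)
          (R.le_shift (-(a + k)) _ this)
  obtain ⟨⟨a, _⟩, ⟨b, _⟩⟩ := hX
  -- If `b < a`, `toNat` may cut off to `0`; the bound `b ≤ a + k - 1` still holds.
  exact key (b - a + 1).toNat a X inferInstance (t.isLE_of_le X b _ (by lia))

variable (F : C ⥤ D)

/-- The objects `Y` such that `F` induces bijections `Hom(X, Y) → Hom(F X, F Y)` for all
objects `X` satisfying `S`. -/
def bijectiveFrom (S : ObjectProperty C) : ObjectProperty C :=
  fun Y => ∀ X : C, S X → Function.Bijective (F.map : (X ⟶ Y) → _)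

/-- The objects `X` such that `F` induces bijections `Hom(X, Y) → Hom(F X, F Y)` for all
objects `Y`. -/
def bijectiveToAll : ObjectProperty C :=
  fun X => ∀ Y : C, Function.Bijective (F.map : (X ⟶ Y) → _)

variable {F}

instance (S : ObjectProperty C) : (bijectiveFrom F S).IsClosedUnderIsomorphisms where
  of_iso e h X hX := bijective_map_of_iso (Iso.refl X) e (h X hX)

instance : (bijectiveToAll F).IsClosedUnderIsomorphisms where
  of_iso e h Y := bijective_map_of_iso e (Iso.refl Y) (h Y)

variable [F.CommShift ℤ] [F.IsTriangulated]

lemma bijective_map_of_isZero_left {X Y : C} (hX : IsZero X) :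
    Function.Bijective (F.map : (X ⟶ Y) → _) :=
  ⟨fun _ _ _ => hX.eq_of_src _ _, fun _ => ⟨0, (F.map_isZero hX).eq_of_src _ _⟩⟩

lemma bijective_map_of_isZero_right {X Y : C} (hY : IsZero Y) :
    Function.Bijective (F.map : (X ⟶ Y) → _) :=
  ⟨fun _ _ _ => hY.eq_of_tgt _ _, fun _ => ⟨0, (F.map_isZero hY).eq_of_tgt _ _⟩⟩

/-- The five lemma for the long exact sequences of `Hom(X, -)` and `Hom(F X, -)`, in the window from
`T.obj₁` to `T.obj₂⟦1⟧`. -/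
lemma bijective_map_obj₃ {T : Triangle C} (hT : T ∈ distTriang C) {X : C}
    (h₁ : Function.Bijective (F.map : (X ⟶ T.obj₁) → _))
    (h₁' : Function.Bijective (F.map : (X ⟶ T.obj₁⟦(1 : ℤ)⟧) → _))
    (h₂ : Function.Bijective (F.map : (X ⟶ T.obj₂) → _))
    (h₂' : Function.Bijective (F.map : (X ⟶ T.obj₂⟦(1 : ℤ)⟧) → _)) :
    Function.Bijective (F.map : (X ⟶ T.obj₃) → _) := by
  constructor
  · change Function.Injective (F.mapAddHom : (X ⟶ T.obj₃) →+ _)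
    rw [injective_iff_map_eq_zero]
    intro f (hf : F.map f = 0)
    obtain ⟨g, rfl⟩ := Triangle.coyoneda_exact₃ T hT f (h₁'.1 (by
      rw [F.map_comp, hf, zero_comp, F.map_zero]))
    obtain ⟨h, hh⟩ := Triangle.coyoneda_exact₂ _ (F.map_distinguished T hT) (F.map g)
      ((F.map_comp _ _).symm.trans hf)
    obtain ⟨h, rfl⟩ := h₁.2 h
    obtain rfl : g = h ≫ T.mor₁ := h₂.1 (hh.trans (F.map_comp _ _).symm)
    rw [Category.assoc, comp_distTriang_mor_zero₁₂ _ hT, comp_zero]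
  · intro f
    obtain ⟨h, hh⟩ := h₁'.2 (f ≫ F.map T.mor₃)
    obtain ⟨g, rfl⟩ := Triangle.coyoneda_exact₁ T hT h (h₂'.1 (by
      rw [F.map_comp, hh, Category.assoc, ← F.map_comp, comp_distTriang_mor_zero₃₁ _ hT,
        F.map_zero, F.map_zero, comp_zero]))
    obtain ⟨k, hk⟩ := Triangle.coyoneda_exact₂ _ (F.map_distinguished _ (rot_of_distTriang _ hT))
      (f - F.map g) (by
        change _ ≫ F.map T.mor₃ = 0
        rw [Preadditive.sub_comp, ← F.map_comp, hh, sub_self])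
    obtain ⟨k, rfl⟩ := h₂.2 k
    refine ⟨g + k ≫ T.mor₂, ?_⟩
    rw [F.map_add, F.map_comp]
    exact (eq_add_of_sub_eq' hk).symm

/-- The contravariant five lemma, for `Hom(-, Y)`. -/
lemma bijective_map_from_obj₃ {T : Triangle C} (hT : T ∈ distTriang C) {Y : C}
    (h₁ : Function.Bijective (F.map : (T.obj₁ ⟶ Y) → _))
    (h₁' : Function.Bijective (F.map : (T.obj₁⟦(1 : ℤ)⟧ ⟶ Y) → _))
    (h₂ : Function.Bijective (F.map : (T.obj₂ ⟶ Y) → _))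
    (h₂' : Function.Bijective (F.map : (T.obj₂⟦(1 : ℤ)⟧ ⟶ Y) → _)) :
    Function.Bijective (F.map : (T.obj₃ ⟶ Y) → _) := by
  have hT' := rot_of_distTriang _ hT
  constructor
  · change Function.Injective (F.mapAddHom : (T.obj₃ ⟶ Y) →+ _)
    rw [injective_iff_map_eq_zero]
    intro f (hf : F.map f = 0)
    obtain ⟨g, rfl⟩ := Triangle.yoneda_exact₃ T hT f (h₂.1 (by
      rw [F.map_comp, hf, comp_zero, F.map_zero]))
    obtain ⟨h, hh⟩ := Triangle.yoneda_exact₂ _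
      (F.map_distinguished _ (rot_of_distTriang _ hT')) (F.map g)
      ((F.map_comp _ _).symm.trans hf)
    obtain ⟨h, rfl⟩ := h₂'.2 h
    -- The sign is that of the second morphism of the triangle rotated twice.
    obtain rfl : g = -T.mor₁⟦(1 : ℤ)⟧' ≫ h := h₁'.1 (by
      rw [← Preadditive.neg_comp, F.map_comp]
      exact hh)
    rw [Preadditive.comp_neg, ← Category.assoc, comp_distTriang_mor_zero₃₁ _ hT, zero_comp,
      neg_zero]
  · intro f
    obtain ⟨g, hg⟩ := h₂.2 (F.map T.mor₂ ≫ f)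
    obtain ⟨k, rfl⟩ := Triangle.yoneda_exact₂ T hT g (h₁.1 (by
      rw [F.map_comp, hg, ← Category.assoc, ← F.map_comp, comp_distTriang_mor_zero₁₂ _ hT,
        F.map_zero, F.map_zero, zero_comp]))
    obtain ⟨l, hl⟩ := Triangle.yoneda_exact₂ _ (F.map_distinguished _ hT') (f - F.map k) (by
      change F.map T.mor₂ ≫ _ = 0
      rw [Preadditive.comp_sub, ← F.map_comp, hg, sub_self])
    obtain ⟨l, rfl⟩ := h₁'.2 l
    refine ⟨k + T.mor₃ ≫ l, ?_⟩
    rw [F.map_add, F.map_comp]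
    exact (eq_add_of_sub_eq' hl).symm

lemma isTriangulated_bijectiveFrom (S : ObjectProperty C) [S.IsStableUnderShift ℤ] :
    (bijectiveFrom F S).IsTriangulated := by
  have hs : (bijectiveFrom F S).IsStableUnderShift ℤ :=
    ⟨fun n => ⟨fun Y hY X hX => bijective_map_shift_right n (hY _ (S.le_shift (-n) _ hX))⟩⟩
  -- Closure under third vertices suffices: with shift stability, rotation gives closure under
  -- middle vertices.
  have : (bijectiveFrom F S).IsTriangulatedClosed₃ := .mk' fun T hT h₁ h₂ X hX =>
    bijective_map_obj₃ hT (h₁ X hX) ((bijectiveFrom F S).le_shift (1 : ℤ) _ h₁ X hX)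
      (h₂ X hX) ((bijectiveFrom F S).le_shift (1 : ℤ) _ h₂ X hX)
  exact { hs, ObjectProperty.IsTriangulatedClosed₂.of_isTriangulatedClosed₃ with
    exists_zero := ⟨_, isZero_zero C, fun X _ => bijective_map_of_isZero_right (isZero_zero C)⟩ }

lemma isTriangulated_bijectiveToAll : (bijectiveToAll F).IsTriangulated := by
  have hs : (bijectiveToAll F).IsStableUnderShift ℤ :=
    ⟨fun n => ⟨fun X hX Y => bijective_map_shift_left n (hX _)⟩⟩
  have : (bijectiveToAll F).IsTriangulatedClosed₃ := .mk' fun T hT h₁ h₂ Y =>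
    bijective_map_from_obj₃ hT (h₁ Y) ((bijectiveToAll F).le_shift (1 : ℤ) _ h₁ Y)
      (h₂ Y) ((bijectiveToAll F).le_shift (1 : ℤ) _ h₂ Y)
  exact { hs, ObjectProperty.IsTriangulatedClosed₂.of_isTriangulatedClosed₃ with
    exists_zero := ⟨_, isZero_zero C, fun Y => bijective_map_of_isZero_left (isZero_zero C)⟩ }

/-- A triangulated functor is bijective on morphisms if it is so on all morphisms `X ⟶ Y⟦n⟧`
with `X` and `Y` in the heart of a bounded t-structure. -/
lemma bijective_map_of_heart [IsTriangulated C] {t : TStructure C} (ht : IsBounded t)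
    (h : ∀ (X Y : C) (n : ℤ), t.heart X → t.heart Y →
      Function.Bijective (F.map : (X ⟶ Y⟦n⟧) → _)) (X Y : C) :
    Function.Bijective (F.map : (X ⟶ Y) → _) := by
  -- The sources range over all shifts of the heart because `bijectiveFrom F S` inherits shift
  -- stability from `S`. The target is extended to all objects before the source.
  have := isTriangulated_bijectiveFrom (F := F) (t.heart.shiftClosure ℤ)
  have := isTriangulated_bijectiveToAll (F := F)
  refine prop_of_heart_le t (bijectiveToAll F) ?_ (ht X) Y
  intro X hX Y
  refine prop_of_heart_le t (bijectiveFrom F (t.heart.shiftClosure ℤ)) ?_ (ht Y) X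
    (t.heart.le_shiftClosure _ hX)
  rintro Y hY _ ⟨X, n, e, hX⟩
  exact bijective_map_of_iso e.symm (Iso.refl _) (bijective_map_shift_left n (h X Y (-n) hX hY))

/-- A full triangulated functor which reflects zero objects is faithful. -/
lemma faithful_of_full [F.Full] (hF : ∀ X : C, IsZero (F.obj X) → IsZero X) : F.Faithful := by
  have hiso {X Y : C} (f : X ⟶ Y) (hf : IsIso (F.map f)) : IsIso f := by
    obtain ⟨Z, g, h, hT⟩ := distinguished_cocone_triangle f
    refine (Triangle.isZero₃_iff_isIso₁ _ hT).1 (hF _ ?_)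
    exact (Triangle.isZero₃_iff_isIso₁ _ (F.map_distinguished _ hT)).2 hf
  have key {X Y : C} (f : X ⟶ Y) (hf : F.map f = 0) : f = 0 := by
    obtain ⟨Z, g, h, hT⟩ := distinguished_cocone_triangle f
    -- As `F.map f = 0`, the image of `g : Y ⟶ Z` is a split monomorphism, and fullness lifts the
    -- retraction.
    obtain ⟨r, hr⟩ := Triangle.yoneda_exact₂ _ (F.map_distinguished _ hT) (𝟙 (F.obj Y)) (by
      change F.map f ≫ _ = 0
      rw [hf, zero_comp])
    obtain ⟨r, rfl⟩ := F.map_surjective (X := Z) r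
    have hgr : F.map (g ≫ r) = 𝟙 _ := (F.map_comp _ _).trans hr.symm
    -- Without faithfulness `g ≫ r` need not be the identity, but it is invertible; this and `f ≫ g
    -- = 0` force `f = 0`.
    have := hiso (g ≫ r) (by rw [hgr]; infer_instance)
    have h₀ : f ≫ g = 0 := comp_distTriang_mor_zero₁₂ _ hT
    rw [← cancel_mono (g ≫ r), ← Category.assoc, h₀, zero_comp, zero_comp]
  exact ⟨fun {X Y f g} hfg => sub_eq_zero.1 (key _ (by rw [F.map_sub, hfg, sub_self]))⟩

end Devissage

/-! ### Conjugation of shifted morphisms by isomorphisms. -/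

section ShiftedHom

universe v₁ u₁

variable {C : Type u₁} [Category.{v₁} C] [HasShift C ℤ]

lemma shiftedHom_conj_comp {X X' Y Y' Z Z' : C} {a b c : ℤ} (i : X' ⟶ X) (x : ShiftedHom X Y a)
    (e : Y ≅ Y') (y : ShiftedHom Y Z b) (j : Z ⟶ Z') (h : b + a = c) :
    i ≫ x.comp y h ≫ j⟦c⟧' =
      ShiftedHom.comp (i ≫ x ≫ e.hom⟦a⟧') (e.inv ≫ y ≫ j⟦b⟧') h := by
  have hj := (shiftFunctorAdd' C b a c h).inv.naturality j
  simp only [ShiftedHom.comp, Functor.map_comp, Category.assoc]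
  rw [← Functor.map_comp_assoc, e.hom_inv_id, CategoryTheory.Functor.map_id, Category.id_comp]
  exact congrArg (fun z => i ≫ x ≫ y⟦a⟧' ≫ z) hj.symm

lemma shiftedHom_conj_comp_inv {X X' Y Y' : C} {a : ℤ} (i : X' ⟶ X) (x : ShiftedHom X Y a)
    (e : Y ≅ Y') : (i ≫ x ≫ e.hom⟦a⟧') ≫ e.inv⟦a⟧' = i ≫ x := by
  rw [Category.assoc, Category.assoc, ← Functor.map_comp, e.hom_inv_id,
    CategoryTheory.Functor.map_id]
  simp

lemma shiftedHom_conj_mk₀ {X X' Y Y' : C} (i : X' ⟶ X) (f : X ⟶ Y) (j : Y ⟶ Y') (a : ℤ)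
    (ha : a = 0) :
    i ≫ ShiftedHom.mk₀ a ha f ≫ j⟦a⟧' = ShiftedHom.mk₀ a ha (i ≫ f ≫ j) := by
  have hj := (shiftFunctorZero' C a ha).inv.naturality j
  simp only [ShiftedHom.mk₀, Category.assoc]
  exact congrArg (fun z => i ≫ f ≫ z) hj.symm

end ShiftedHom

/-! ### Comparison of the canonical Ext maps with a realization functor. -/

section BoundedExt

variable {T : Type u} [Category.{v} T] [Preadditive T] [HasZeroObject T] [HasShift T ℤ]
  [∀ n : ℤ, (shiftFunctor T n).Additive] [Pretriangulated T] [IsTriangulated T]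
  {t : TStructure T}

/-- The bijection between `Extⁿ(A, B)` and `Hom(A, B[n])` in the bounded derived category. -/
noncomputable def boundedExtEquiv (n : ℕ) (A B : t.heart.FullSubcategory) :
    Ext.{max u v} A B n ≃
      ShiftedHom ((heartToBounded t).obj A) ((heartToBounded t).obj B) (n : ℤ) :=
  Ext.homEquiv.trans
    ((((DerivedCategory.Bounded.ι (C := t.heart.FullSubcategory)).commShiftIso
      (n : ℤ)).symm.app ((heartToBounded t).obj B)).homToEquiv.trans
    (DerivedCategory.TStructure.t.bounded.fullyFaithfulι.homEquiv
      (X := (heartToBounded t).obj A) (Y := ((heartToBounded t).obj B)⟦(n : ℤ)⟧)).symm)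

lemma map_boundedExtEquiv {n : ℕ} {A B : t.heart.FullSubcategory} (x : Ext.{max u v} A B n) :
    (boundedExtEquiv n A B x).map DerivedCategory.Bounded.ι = x.hom := by
  have h : DerivedCategory.Bounded.ι.map (boundedExtEquiv n A B x) = x.hom ≫
      ((DerivedCategory.Bounded.ι (C := t.heart.FullSubcategory)).commShiftIso
        (n : ℤ)).inv.app ((heartToBounded t).obj B) := rfl
  have h' {X Y Z : DerivedCategory t.heart.FullSubcategory} (f : X ⟶ Y) (e : Z ≅ Y) :
      (f ≫ e.inv) ≫ e.hom = f := by simp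
  rw [ShiftedHom.map, h]
  exact h' _ ((DerivedCategory.Bounded.ι.commShiftIso (n : ℤ)).app _)

lemma boundedHom_ext {A B : t.heart.FullSubcategory} {a : ℤ}
    {x y : ShiftedHom ((heartToBounded t).obj A) ((heartToBounded t).obj B) a}
    (h : x.map DerivedCategory.Bounded.ι = y.map DerivedCategory.Bounded.ι) : x = y := by
  rw [ShiftedHom.map, ShiftedHom.map, cancel_mono] at h
  exact DerivedCategory.Bounded.ι.map_injective h

lemma boundedExtEquiv_mk₀ {A B : t.heart.FullSubcategory} (g : A ⟶ B) :
    boundedExtEquiv 0 A B (Ext.mk₀ g) =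
      ShiftedHom.mk₀ ((0 : ℕ) : ℤ) (by simp) ((heartToBounded t).map g) := by
  apply boundedHom_ext
  rw [map_boundedExtEquiv, ShiftedHom.map_mk₀, Ext.mk₀_hom]
  rfl

lemma boundedExtEquiv_comp {A B C : t.heart.FullSubcategory} {a b c : ℕ}
    (x : Ext.{max u v} A B a) (y : Ext.{max u v} B C b) (h : a + b = c) :
    boundedExtEquiv c A C (x.comp y h) =
      (boundedExtEquiv a A B x).comp (boundedExtEquiv b B C y) (by lia) := by
  apply boundedHom_ext
  rw [map_boundedExtEquiv, ShiftedHom.map_comp, map_boundedExtEquiv, map_boundedExtEquiv,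
    Ext.comp_hom]
  rfl

/-- Distinguished triangles in `D^b` are tested in the full derived category, where this one becomes
`hS.singleTriangle`. -/
lemma boundedExtEquiv_extClass_distinguished {S : ShortComplex t.heart.FullSubcategory}
    (hS : S.ShortExact) :
    Triangle.mk ((heartToBounded t).map S.f) ((heartToBounded t).map S.g)
      (boundedExtEquiv 1 _ _ hS.extClass) ∈
        distTriang (DerivedCategory.Bounded t.heart.FullSubcategory) := by
  have h := map_boundedExtEquiv hS.extClass
  rw [hS.extClass_hom] at h
  have hT : (DerivedCategory.Bounded.ι (C := t.heart.FullSubcategory)).mapTriangle.obj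
      (Triangle.mk ((heartToBounded t).map S.f) ((heartToBounded t).map S.g)
        (boundedExtEquiv 1 _ _ hS.extClass)) = hS.singleTriangle :=
    congrArg (Triangle.mk ((DerivedCategory.singleFunctor _ 0).map S.f)
      ((DerivedCategory.singleFunctor _ 0).map S.g)) h
  have h := hS.singleTriangle_distinguished
  rw [← hT] at h
  exact h

namespace RealizationFunctor

variable (r : RealizationFunctor t)

/-- The map `Hom(A, B[n]) → Hom(A, B[n])` induced by a realization functor. -/
noncomputable def mapHom {A B : t.heart.FullSubcategory} {a : ℤ}
    (x : ShiftedHom ((heartToBounded t).obj A) ((heartToBounded t).obj B) a) :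
    ShiftedHom (t.heart.ι.obj A) (t.heart.ι.obj B) a :=
  r.iso.inv.app A ≫ x.map r.functor ≫ (r.iso.hom.app B)⟦a⟧'

lemma mapHom_eq_comp {A B : t.heart.FullSubcategory} {a : ℤ}
    (x : ShiftedHom ((heartToBounded t).obj A) ((heartToBounded t).obj B) a) :
    r.mapHom x = r.iso.inv.app A ≫ r.functor.map x ≫
      ((r.functor.commShiftIso a).app _ ≪≫
        (shiftFunctor T a).mapIso (r.iso.app B)).hom := by
  simp [mapHom, ShiftedHom.map]

lemma mapHom_bijective_iff (A B : t.heart.FullSubcategory) (a : ℤ) :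
    Function.Bijective (r.mapHom (A := A) (B := B) (a := a)) ↔
      Function.Bijective (r.functor.map : ((heartToBounded t).obj A ⟶
        ((heartToBounded t).obj B)⟦a⟧) → _) := by
  let e := ((r.iso.app A).homFromEquiv (Z := r.functor.obj (((heartToBounded t).obj B)⟦a⟧))).trans
    ((r.functor.commShiftIso a).app _ ≪≫
        (shiftFunctor T a).mapIso (r.iso.app B)).homToEquiv
  rw [← Function.Bijective.of_comp_iff' e.bijective]
  have : r.mapHom (A := A) (B := B) (a := a) = e ∘ r.functor.map := by
    ext x
    rw [mapHom_eq_comp]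
    exact (Category.assoc _ _ _).symm
  rw [this]

lemma mapHom_mk₀ {A B : t.heart.FullSubcategory} (g : A ⟶ B) (m₀ : ℤ) (hm₀ : m₀ = 0) :
    r.mapHom (ShiftedHom.mk₀ m₀ hm₀ ((heartToBounded t).map g)) =
      ShiftedHom.mk₀ m₀ hm₀ (t.heart.ι.map g) := by
  rw [mapHom, ShiftedHom.map_mk₀]
  refine (shiftedHom_conj_mk₀ _ _ _ _ _).trans (congrArg (ShiftedHom.mk₀ m₀ hm₀) ?_)
  exact (NatIso.naturality_1 r.iso g)

lemma mapHom_comp {A B C : t.heart.FullSubcategory} {a b c : ℤ}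
    (x : ShiftedHom ((heartToBounded t).obj A) ((heartToBounded t).obj B) a)
    (y : ShiftedHom ((heartToBounded t).obj B) ((heartToBounded t).obj C) b) (h : b + a = c) :
    r.mapHom (x.comp y h) = (r.mapHom x).comp (r.mapHom y) h := by
  rw [mapHom, ShiftedHom.map_comp]
  exact shiftedHom_conj_comp _ _ (r.iso.app B) _ _ h

/-- Applying the exact functor and transporting along `r.iso` gives a distinguished triangle on the
same sequence, and its last morphism is unique. -/
lemma mapHom_eq_connecting {S : ShortComplex t.heart.FullSubcategory} (hS : S.ShortExact)
    {d : ShiftedHom ((heartToBounded t).obj S.X₃) ((heartToBounded t).obj S.X₁) (1 : ℤ)}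
    (hd : Triangle.mk ((heartToBounded t).map S.f) ((heartToBounded t).map S.g) d ∈ distTriang _) :
    r.mapHom d = connecting hS := by
  refine (existsUnique_connecting hS).unique ?_ (connecting_distinguished hS)
  refine isomorphic_distinguished _ (r.functor.map_distinguished _ hd) _
    (Triangle.isoMk _ _ (r.iso.symm.app _) (r.iso.symm.app _) (r.iso.symm.app _) ?_ ?_ ?_)
  · exact r.iso.inv.naturality S.f
  · exact r.iso.inv.naturality S.g
  · exact shiftedHom_conj_comp_inv _ _ (r.iso.app S.X₁)

/-- Induction on the length of the extension: `mapHom` and `boundedExtEquiv` respect composition, so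
only morphisms of the heart and single extension classes need checking. -/
lemma eq_mapHom_of_isComposite {n : ℕ} {A B : t.heart.FullSubcategory} {x : Ext.{max u v} A B n}
    {α : ShiftedHom (t.heart.ι.obj A) (t.heart.ι.obj B) (n : ℤ)} (h : IsComposite n x α) :
    α = r.mapHom (boundedExtEquiv n A B x) := by
  induction n generalizing A B with
  | zero =>
    obtain ⟨g, rfl, rfl⟩ := h
    rw [boundedExtEquiv_mk₀, mapHom_mk₀]
  | succ n hn =>
    obtain ⟨K, X, i, p, w, hS, y, β, h, rfl, rfl⟩ := h
    rw [boundedExtEquiv_comp, mapHom_comp, ← hn h]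
    congr 1
    exact (r.mapHom_eq_connecting hS (boundedExtEquiv_extClass_distinguished hS)).symm

lemma extComparison_eq {n : ℕ} {A B : t.heart.FullSubcategory} (x : Ext.{max u v} A B n) :
    extComparison n A B x = r.mapHom (boundedExtEquiv n A B x) :=
  r.eq_mapHom_of_isComposite ((isComposite_iff x _).2 rfl)

lemma hasAllExt_iff : HasAllExt t ↔ ∀ (n : ℕ) (A B : t.heart.FullSubcategory),
    Function.Bijective (r.functor.map : ((heartToBounded t).obj A ⟶
        ((heartToBounded t).obj B)⟦(n : ℤ)⟧) → _) := by
  refine forall_congr' fun n => forall_congr' fun A => forall_congr' fun B => ?_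
  rw [← mapHom_bijective_iff, ← Function.Bijective.of_comp_iff _ (boundedExtEquiv n A B).bijective]
  have : (extComparison n A B : _ → _) = r.mapHom ∘ boundedExtEquiv n A B :=
    funext r.extComparison_eq
  rw [this]

end RealizationFunctor

end BoundedExt

/-! ### Full faithfulness, conservativity and essential surjectivity of a realization functor. -/

section Equivalence

variable {T : Type u} [Category.{v} T] [Preadditive T] [HasZeroObject T] [HasShift T ℤ]
  [∀ n : ℤ, (shiftFunctor T n).Additive] [Pretriangulated T] [IsTriangulated T]
  (t : TStructure T)

/-- The canonical t-structure on the bounded derived category of the heart. -/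
noncomputable abbrev boundedTStructure :
    TStructure (DerivedCategory.Bounded t.heart.FullSubcategory) :=
  DerivedCategory.TStructure.t.onBounded

lemma isBounded_boundedTStructure : IsBounded (boundedTStructure t) := by
  rintro ⟨X, ⟨a, ha⟩, ⟨b, hb⟩⟩
  exact ⟨⟨a, (ObjectProperty.tStructure_isGE_iff _ _ _ _).2 ha⟩,
    ⟨b, (ObjectProperty.tStructure_isLE_iff _ _ _ _).2 hb⟩⟩

variable {t}

lemma exists_iso_heartToBounded_obj {X : DerivedCategory.Bounded t.heart.FullSubcategory}
    (hX : (boundedTStructure t).heart X) :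
    ∃ A : t.heart.FullSubcategory, Nonempty (X ≅ (heartToBounded t).obj A) := by
  obtain ⟨h₁, h₂⟩ := ((boundedTStructure t).mem_heart_iff _).1 hX
  have : X.obj.IsLE 0 := (ObjectProperty.tStructure_isLE_iff _ _ _ _).1 h₁
  have : X.obj.IsGE 0 := (ObjectProperty.tStructure_isGE_iff _ _ _ _).1 h₂
  obtain ⟨A, ⟨e⟩⟩ := DerivedCategory.exists_iso_singleFunctor_obj_of_isGE_of_isLE X.obj 0
  exact ⟨A, ⟨DerivedCategory.TStructure.t.bounded.fullyFaithfulι.preimageIso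
    (Y := (heartToBounded t).obj A) e⟩⟩

namespace RealizationFunctor

variable (r : RealizationFunctor t)

lemma heart_functor_obj {X : DerivedCategory.Bounded t.heart.FullSubcategory}
    (hX : (boundedTStructure t).heart X) : t.heart (r.functor.obj X) := by
  obtain ⟨A, ⟨e⟩⟩ := exists_iso_heartToBounded_obj hX
  exact t.heart.prop_of_iso (r.functor.mapIso e ≪≫ r.iso.app A).symm A.property

/-- On the heart the functor is isomorphic to the inclusion, which is faithful and so detects `𝟙 A =
0`. -/
lemma isZero_of_heart {X : DerivedCategory.Bounded t.heart.FullSubcategory}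
    (hX : (boundedTStructure t).heart X) (h : IsZero (r.functor.obj X)) : IsZero X := by
  obtain ⟨A, ⟨e⟩⟩ := exists_iso_heartToBounded_obj hX
  have hA : IsZero (t.heart.ι.obj A) := h.of_iso (r.functor.mapIso e ≪≫ r.iso.app A).symm
  have hA : 𝟙 A = 0 := t.heart.ι.map_injective (hA.eq_of_src _ _)
  have : (heartToBounded t).map (𝟙 A) = 0 := by
    rw [hA]
    exact DerivedCategory.Bounded.ι.map_injective
      ((DerivedCategory.singleFunctor t.heart.FullSubcategory 0).map_zero A A)
  rw [CategoryTheory.Functor.map_id, ← IsZero.iff_id_eq_zero] at this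
  exact this.of_iso e

lemma bijective_map_of_neg {X Y : DerivedCategory.Bounded t.heart.FullSubcategory}
    (hX : (boundedTStructure t).heart X) (hY : (boundedTStructure t).heart Y) {n : ℤ}
    (hn : n < 0) : Function.Bijective (r.functor.map : (X ⟶ Y⟦n⟧) → _) := by
  have h₁ : ∀ f : X ⟶ Y⟦n⟧, f = 0 :=
    fun f => hom_shift_eq_zero (boundedTStructure t) (X := ⟨X, hX⟩) (Y := ⟨Y, hY⟩) f hn
  have h₂ : ∀ f : r.functor.obj X ⟶ r.functor.obj (Y⟦n⟧), f = 0 := fun f => by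
    have := hom_shift_eq_zero t (X := ⟨_, r.heart_functor_obj hX⟩)
      (Y := ⟨_, r.heart_functor_obj hY⟩) (f ≫ (r.functor.commShiftIso n).hom.app Y) hn
    exact (Preadditive.IsIso.comp_right_eq_zero _ _).1 this
  exact ⟨fun f g _ => (h₁ f).trans (h₁ g).symm, fun f => ⟨0, (h₂ _).trans (h₂ f).symm⟩⟩

lemma bijective_map_of_hasAllExt (h : HasAllExt t)
    (X Y : DerivedCategory.Bounded t.heart.FullSubcategory) :
    Function.Bijective (r.functor.map : (X ⟶ Y) → _) := by
  refine bijective_map_of_heart (isBounded_boundedTStructure t) (fun X Y n hX hY => ?_) X Y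
  by_cases hn : n < 0
  · exact r.bijective_map_of_neg hX hY hn
  · obtain ⟨n, rfl⟩ := Int.eq_ofNat_of_zero_le (not_lt.1 hn)
    obtain ⟨A, ⟨e⟩⟩ := exists_iso_heartToBounded_obj hX
    obtain ⟨B, ⟨e'⟩⟩ := exists_iso_heartToBounded_obj hY
    exact bijective_map_of_iso e.symm ((shiftFunctor _ (n : ℤ)).mapIso e'.symm)
      (r.hasAllExt_iff.1 h n A B)

/-- Fullness makes the essential image closed under cones, since a morphism between images lifts and
its cone can be taken in `D^b`. -/
lemma essSurj_of_full (ht : IsBounded t) [r.functor.Full] : r.functor.EssSurj where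
  mem_essImage Y := prop_of_heart_le t r.functor.essImage
    (fun X hX => ⟨(heartToBounded t).obj ⟨X, hX⟩, ⟨r.iso.app ⟨X, hX⟩⟩⟩) (ht Y)

/-- A realization functor is right t-exact and reflects zero objects. -/
lemma isLE_functor_obj_and_isZero (k : ℕ) (a : ℤ) :
    ∀ X : DerivedCategory.Bounded t.heart.FullSubcategory,
      (boundedTStructure t).IsGE X a → (boundedTStructure t).IsLE X (a + k - 1) →
      t.IsLE (r.functor.obj X) (a + k - 1) ∧ (IsZero (r.functor.obj X) → IsZero X) := by
  -- Again `k` counts degrees. Both claims go through one induction because reflecting zero objects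
  -- uses the upper bound for the lower truncation.
  induction k with
  | zero =>
    intro X _ _
    have hX := (boundedTStructure t).isZero X (a + (0 : ℕ) - 1) a (by lia)
    exact ⟨t.isLE_of_isZero (r.functor.map_isZero hX) _, fun _ => hX⟩
  | succ k hk =>
    intro X _ hX
    rw [show a + ((k + 1 : ℕ) : ℤ) - 1 = a + k by lia] at hX ⊢
    have hT := (boundedTStructure t).triangleLEGE_distinguished (a + k - 1) (a + k) (by lia) X
    let L := ((boundedTStructure t).truncLE (a + k - 1)).obj X
    let M := ((boundedTStructure t).truncGE (a + k)).obj X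
    obtain ⟨hL, hL'⟩ := hk L inferInstance inferInstance
    have hM : (boundedTStructure t).heart (M⟦a + k⟧) := ((boundedTStructure t).mem_heart_iff _).2
      ⟨(boundedTStructure t).isLE_shift M (a + k) (a + k) 0,
        (boundedTStructure t).isGE_shift M (a + k) (a + k) 0⟩
    let e := (r.functor.commShiftIso (a + k)).app M
    have hFM := (t.mem_heart_iff _).1 (t.heart.prop_of_iso e (r.heart_functor_obj hM))
    have hM₁ : t.IsLE (r.functor.obj M) (a + k) := (t.isLE_shift_iff _ _ _ 0).1 hFM.1
    have hM₂ : t.IsGE (r.functor.obj M) (a + k) := (t.isGE_shift_iff _ _ _ 0).1 hFM.2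
    have hFT := r.functor.map_distinguished _ hT
    have hL₁ : t.IsLE (r.functor.obj L) (a + k) := t.isLE_of_le _ (a + k - 1) _
    refine ⟨t.isLE₂ _ hFT _ hL₁ hM₁, fun h => ?_⟩
    -- If the middle vertex vanishes, the image of `M` is that of `L` shifted by one, hence in
    -- degrees `≤ a + k - 2`; but it is also in degrees `≥ a + k`.
    have hFM : IsZero (r.functor.obj M) := by
      have := (Triangle.isZero₂_iff_isIso₃ _ hFT).1 h
      let e₃ : r.functor.obj M ≅ (r.functor.obj L)⟦(1 : ℤ)⟧ := @asIso _ _ _ _ _ this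
      have : t.IsLE ((r.functor.obj L)⟦(1 : ℤ)⟧) (a + k - 2) := t.isLE_shift _ (a + k - 1) 1 _
      have : t.IsLE (r.functor.obj M) (a + k - 2) := t.isLE_of_iso e₃.symm _
      exact t.isZero _ (a + k - 2) (a + k)
    have hM₀ : IsZero (M⟦a + k⟧) :=
      r.isZero_of_heart hM (((shiftFunctor T (a + k)).map_isZero hFM).of_iso e)
    have hM₀ : IsZero M := ((shiftFunctor _ (-(a + k))).map_isZero hM₀).of_iso
      ((shiftEquiv _ (a + k)).unitIso.app M)
    have hL₀ : IsZero L := hL' ((Triangle.isZero₁_iff_isIso₂ _ hFT).2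
      ⟨0, h.eq_of_src _ _, hFM.eq_of_src _ _⟩)
    exact (Triangle.isZero₂_iff _ hT).2 ⟨hL₀.eq_of_src _ _, hM₀.eq_of_tgt _ _⟩

lemma isZero_of_isZero_functor_obj (X : DerivedCategory.Bounded t.heart.FullSubcategory)
    (h : IsZero (r.functor.obj X)) : IsZero X := by
  obtain ⟨⟨a, _⟩, ⟨b, _⟩⟩ := isBounded_boundedTStructure t X
  exact (r.isLE_functor_obj_and_isZero (b - a + 1).toNat a X inferInstance
    ((boundedTStructure t).isLE_of_le X b _ (by lia))).2 h

lemma hasAllExt_of_full_of_faithful [r.functor.Full] [r.functor.Faithful] : HasAllExt t :=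
  r.hasAllExt_iff.2 fun _ _ _ => ⟨r.functor.map_injective, r.functor.map_surjective⟩

lemma tfae : [HasAllExt t, r.functor.Full ∧ r.functor.Faithful, r.functor.Full].TFAE := by
  tfae_have 1 → 2 := fun h =>
    ⟨⟨fun {X Y} => (r.bijective_map_of_hasAllExt h X Y).2⟩,
      ⟨fun {X Y} => @(r.bijective_map_of_hasAllExt h X Y).1⟩⟩
  tfae_have 2 → 3 := fun h => h.1
  tfae_have 3 → 1 := fun _ => by
    have := faithful_of_full r.isZero_of_isZero_functor_obj
    exact r.hasAllExt_of_full_of_faithful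
  tfae_finish

end RealizationFunctor

end Equivalence

/-! ### Exact functors on bounded derived categories. -/

section DerivedFunctor

universe v₁ u₁ w₁ v₂ u₂ w₂

variable {C : Type u₁} [Category.{v₁} C] [Abelian C] [HasDerivedCategory.{w₁} C]
  {D : Type u₂} [Category.{v₂} D] [Abelian D] [HasDerivedCategory.{w₂} D]
  (F : C ⥤ D) [F.Additive] [PreservesFiniteLimits F] [PreservesFiniteColimits F]

/-- Each bound is witnessed by a complex that is strictly zero beyond it, and applying `F` termwise
preserves this. -/
lemma bounded_mapDerivedCategory_obj {X : DerivedCategory C}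
    (hX : DerivedCategory.TStructure.t.bounded X) :
    DerivedCategory.TStructure.t.bounded (F.mapDerivedCategory.obj X) := by
  obtain ⟨⟨a, ⟨K, e, hK⟩⟩, ⟨b, ⟨L, e', hL⟩⟩⟩ := hX
  let e₁ := F.mapDerivedCategory.mapIso e ≪≫ F.mapDerivedCategoryFactors.app K
  let e₂ := F.mapDerivedCategory.mapIso e' ≪≫ F.mapDerivedCategoryFactors.app L
  exact ⟨⟨a, ⟨_, e₁, inferInstance⟩⟩, ⟨b, ⟨_, e₂, inferInstance⟩⟩⟩

/-- The functor between bounded derived categories induced by an exact functor. -/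
noncomputable def mapBounded : DerivedCategory.Bounded C ⥤ DerivedCategory.Bounded D :=
  DerivedCategory.TStructure.t.bounded.lift (DerivedCategory.Bounded.ι ⋙ F.mapDerivedCategory)
    (fun X => bounded_mapDerivedCategory_obj F X.property)

noncomputable instance : (mapBounded F).CommShift ℤ := by
  dsimp only [mapBounded]
  infer_instance

instance : (mapBounded F).IsTriangulated := by
  dsimp only [mapBounded]
  infer_instance

end DerivedFunctor

/-! ### Existence of a realization functor, via the subcategory of all objects. -/

section Existence

variable {T : Type u} [Category.{v} T] [Preadditive T] [HasZeroObject T] [HasShift T ℤ]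
  [∀ n : ℤ, (shiftFunctor T n).Additive] [Pretriangulated T]

instance isTriangulated_top : (⊤ : ObjectProperty T).IsTriangulated where
  exists_zero := ⟨_, isZero_zero T, trivial⟩
  isStableUnderShiftBy _ := ⟨fun _ _ => trivial⟩
  ext₂' T _ _ _ := ⟨T.obj₂, trivial, ⟨Iso.refl _⟩⟩

instance hasInducedTStructure_top (t : TStructure T) :
    (⊤ : ObjectProperty T).HasInducedTStructure t :=
  .mk' fun _ _ _ => ⟨trivial, trivial⟩

variable (t : TStructure T)

/-- The t-structure `t`, considered on the full subcategory of all objects. -/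
noncomputable abbrev topTStructure : TStructure (⊤ : ObjectProperty T).FullSubcategory :=
  (⊤ : ObjectProperty T).tStructure t

lemma isBounded_topTStructure (ht : IsBounded t) : IsBounded (topTStructure t) := by
  intro X
  obtain ⟨⟨a, ha⟩, ⟨b, hb⟩⟩ := ht X.obj
  exact ⟨⟨a, (ObjectProperty.tStructure_isGE_iff _ _ _ _).2 ha⟩,
    ⟨b, (ObjectProperty.tStructure_isLE_iff _ _ _ _).2 hb⟩⟩

/-- The heart of a t-structure is equivalent to the heart of the same t-structure on the full
subcategory of all objects. -/
def heartToTop : t.heart.FullSubcategory ≌ (topTStructure t).heart.FullSubcategory where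
  functor := (topTStructure t).heart.lift ((⊤ : ObjectProperty T).lift t.heart.ι fun _ => trivial)
    fun X => X.property
  inverse := t.heart.lift ((topTStructure t).heart.ι ⋙ ObjectProperty.ι _) fun X => X.property
  unitIso := Iso.refl _
  counitIso := Iso.refl _

instance : (heartToTop t).functor.Additive where

variable [IsTriangulated T]

/-- The embedding of the heart in the bounded derived category is compatible with the
equivalence `heartToTop`. -/
noncomputable def heartToBoundedCompMapBounded :
    heartToBounded t ⋙ mapBounded (heartToTop t).functor ≅
      (heartToTop t).functor ⋙ heartToBounded (topTStructure t) :=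
  -- The isomorphism exists in the unbounded derived category and lifts through the fully faithful
  -- inclusion.
  DerivedCategory.TStructure.t.bounded.fullyFaithfulι.whiskeringRight _ |>.preimageIso
    ((heartToTop t).functor.mapDerivedCategorySingleFunctor 0)

/-- A realization functor for a t-structure on the full subcategory of all objects induces
one on the category itself. -/
noncomputable def RealizationFunctor.ofTop (r : RealizationFunctor (topTStructure t)) :
    RealizationFunctor t where
  functor := mapBounded (heartToTop t).functor ⋙ r.functor ⋙ (⊤ : ObjectProperty T).ι
  commShift := inferInstance
  isTriangulated := inferInstance
  iso := Functor.isoWhiskerRight (heartToBoundedCompMapBounded t)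
      (r.functor ⋙ (⊤ : ObjectProperty T).ι) ≪≫
    Functor.isoWhiskerLeft (heartToTop t).functor
      (Functor.isoWhiskerRight r.iso (⊤ : ObjectProperty T).ι)

variable {t}

lemma IsRealized.nonempty_realizationFunctor (hT : IsRealized T) (ht : IsBounded t) :
    Nonempty (RealizationFunctor t) :=
  (hT ⊤ (topTStructure t) (isBounded_topTStructure t ht)).map (RealizationFunctor.ofTop t)

end Existence

end HeartRealization

theorem mainTheorem8 {T : Type u} [Category.{v} T] [Preadditive T] [HasZeroObject T] [HasShift T ℤ]
    [∀ n : ℤ, (shiftFunctor T n).Additive] [Pretriangulated T] [IsTriangulated T]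
    (hT : HeartRealization.IsRealized T) (t : TStructure T) (ht : HeartRealization.IsBounded t) :
    Nonempty (HeartRealization.RealizationFunctor t) ∧
    ∀ real : HeartRealization.RealizationFunctor t,
      [HeartRealization.HasAllExt t,
        real.functor.Full ∧ real.functor.Faithful,
        real.functor.Full].TFAE ∧
      (HeartRealization.HasAllExt t →
        real.functor.IsTriangulated ∧ real.functor.IsEquivalence) := by
  refine ⟨hT.nonempty_realizationFunctor ht, fun real => ⟨real.tfae, fun h => ?_⟩⟩
  obtain ⟨_, _⟩ := (real.tfae.out 0 1).1 h
  have := real.essSurj_of_full ht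
  exact ⟨real.isTriangulated, {}⟩
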